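/- Let $\mathcal C$ be an additive category and let $\mathbb E:\mathcal C^{\mathrm{op}}\times\mathcal C\to \mathrm{Ab}$ be a biadditive functor. For $\delta\in\mathbb E(C,A)$, $a:A\to A'$ and $c:C'\to C$ write $a_*\delta=\mathbb E(C,a)(\delta)$ and $c^*\delta=\mathbb E(c,A)(\delta)$. For $\delta\in\mathbb E(C,A)$ and $\rho\in\mathbb E(D,B)$, a morphism $(a,c):\delta\to\rho$ is a pair $a:A\to B$, $c:C\to D$ with $a_*\delta=c^*\rho$, and $\delta\oplus\rho\in\mathbb E(C\oplus D,A\oplus B)$ is the element with components $(\delta,0,0,\rho)$. Let $\mathfrak s$ be a correspondence that associates with every $\delta\in\mathbb E(C,A)$ a class $\mathfrak s(\delta)$ of sequences $A\to B\to C$; we say that the members of $\mathfrak s(\delta)$ realize $\delta$. Then $(\mathcal C,\mathbb E,\mathfrak s)$ is a $1$-exangulated category if and only if it is an extriangulated category, in the following sense. **$1$-exangulated.** Each $\mathfrak s(\delta)$, $\delta\in\mathbb E(C,A)$, is a homotopy equivalence class in the category of complexes $X=(A\xrightarrow{d_X^0}X^1\xrightarrow{d_X^1}C)$ with morphisms $(\mathrm{id}_A,f^1,\mathrm{id}_C)$;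 here $f,g:X\to Y$ are homotopic if there are $\varphi^1:X^1\to A$ and $\varphi^2:C\to Y^1$ with $\varphi^1d_X^0=0$, $g^1-f^1=d_Y^0\varphi^1+\varphi^2d_X^1$ and $d_Y^1\varphi^2=0$. Moreover: - (R0) if $X$ realizes $\delta$ and $Y$ realizes $\rho$, every morphism $(a,c):\delta\to\rho$ lifts to a morphism of complexes $(a,b,c):X\to Y$; - (R1) if $X=(A\to X^1\to C)$ realizes $\delta$, then the sequences $\mathcal C(Q,A)\to\mathcal C(Q,X^1)\to\mathcal C(Q,C)\xrightarrow{f\mapsto f^*\delta}\mathbb E(Q,A)$ and $\mathcal C(C,Q)\to\mathcal C(X^1,Q)\to\mathcal C(A,Q)\xrightarrow{f\mapsto f_*\delta}\mathbb E(C,Q)$ are exact for every object $Q$; - (R2) for every object $A$ and every zero object $0$, the zero element of $\mathbb E(0,A)$ is realized by $A\xrightarrow{\mathrm{id}}A\to0$ and the zero element of $\mathbb E(A,0)$ by $0\to A\xrightarrow{\mathrm{id}}A$; - (EA1) the first morphisms of realizing sequences (inflations) are closed under composition, and so are the last ones (deflations); - (EA2) if $\rho\in\mathbb E(D,A)$,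 $c:C\to D$, $X=(A\to X^1\to C)$ realizes $c^*\rho$ and $Y=(A\to Y^1\to D)$ realizes $\rho$, then there is a morphism of complexes $(\mathrm{id}_A,b,c):X\to Y$ such that $X^1\xrightarrow{\binom{-d_X^1}{b}}C\oplus Y^1\xrightarrow{(c\ \ d_Y^1)}D$ realizes $(d_X^0)_*\rho$; - (EA2$^{\mathrm{op}}$) if $\delta\in\mathbb E(C,A)$, $a:A\to B$, $X=(A\to X^1\to C)$ realizes $\delta$ and $Y=(B\to Y^1\to C)$ realizes $a_*\delta$, then there is a morphism of complexes $(a,b,\mathrm{id}_C):X\to Y$ such that $A\xrightarrow{\binom{a}{d_X^0}}B\oplus X^1\xrightarrow{(-d_Y^0\ \ b)}Y^1$ realizes $(d_Y^1)^*\delta$. **Extriangulated** (Nakaoka–Palu). - (ET1) $\mathbb E$ is biadditive. - (ET2) Each $\mathfrak s(\delta)$, $\delta\in\mathbb E(C,A)$, is an equivalence class of sequences $A\to B\to C$, where two sequences $A\to B\to C$ and $A\to B'\to C$ are equivalent if there is an isomorphism $B\to B'$ compatible with $\mathrm{id}_A$ and $\mathrm{id}_C$; condition (R0) holds; $0\in\mathbb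 E(C,A)$ is realized by the split sequence $A\to A\oplus C\to C$; and if $X$ realizes $\delta$ and $Y$ realizes $\rho$, then $X\oplus Y$ realizes $\delta\oplus\rho$. - (ET3) If $A\xrightarrow{x}B\xrightarrow{y}C$ realizes $\delta$, $A'\xrightarrow{x'}B'\xrightarrow{y'}C'$ realizes $\delta'$, and $a:A\to A'$, $b:B\to B'$ satisfy $bx=x'a$, then there is $c:C\to C'$ with $cy=y'b$ and $a_*\delta=c^*\delta'$. - (ET3$^{\mathrm{op}}$) In the same situation, if $b:B\to B'$, $c:C\to C'$ satisfy $cy=y'b$, then there is $a:A\to A'$ with $bx=x'a$ and $a_*\delta=c^*\delta'$. - (ET4) If $A\xrightarrow{f}B\xrightarrow{f'}D$ realizes $\delta\in\mathbb E(D,A)$ and $B\xrightarrow{g}C\xrightarrow{g'}F$ realizes $\delta'\in\mathbb E(F,B)$, then there are an object $G$, morphisms $h':C\to G$, $d:D\to G$, $e:G\to F$ and $\delta''\in\mathbb E(G,A)$ realized by $A\xrightarrow{gf}C\xrightarrow{h'}G$ such that $df'=h'g$, $eh'=g'$, the sequence $D\xrightarrow{d}G\xrightarrow{e}F$ realizes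 $f'_*\delta'$, $d^*\delta''=\delta$ and $f_*\delta''=e^*\delta'$. - (ET4$^{\mathrm{op}}$) If $D\xrightarrow{f'}A\xrightarrow{f}B$ realizes $\delta\in\mathbb E(B,D)$ and $F\xrightarrow{g'}B\xrightarrow{g}C$ realizes $\delta'\in\mathbb E(C,F)$, then there are an object $G$, morphisms $h':G\to A$, $d:D\to G$, $e:G\to F$ and $\delta''\in\mathbb E(C,G)$ realized by $G\xrightarrow{h'}A\xrightarrow{gf}C$ such that $h'd=f'$, $g'e=fh'$, the sequence $D\xrightarrow{d}G\xrightarrow{e}F$ realizes $g'^*\delta$, $e_*\delta''=\delta'$ and $d_*\delta=g^*\delta''$. -/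

import Mathlib

open CategoryTheory CategoryTheory.Limits Opposite

universe w v u

namespace Exangulated

/-! ### Extensions -/

section Extensions

variable {𝒞 : Type u} [Category.{v} 𝒞]

/-- The group `E(C, A)` of extensions, for a bifunctor `E : 𝒞ᵒᵖ × 𝒞 ⥤ Ab` (in curried form). -/
abbrev Ext (E : 𝒞ᵒᵖ ⥤ 𝒞 ⥤ AddCommGrpCat.{w}) (C A : 𝒞) : Type w :=
  (E.obj (op C)).obj A

/-- The action `a_* = E(C, a) : E(C, A) → E(C, A')` of a morphism `a : A ⟶ A'`. -/
def push (E : 𝒞ᵒᵖ ⥤ 𝒞 ⥤ AddCommGrpCat.{w}) {C A A' : 𝒞} (a : A ⟶ A') :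
    Ext E C A →+ Ext E C A' :=
  ((E.obj (op C)).map a).hom

/-- The action `c^* = E(c, A) : E(C, A) → E(C', A)` of a morphism `c : C' ⟶ C`. -/
def pull (E : 𝒞ᵒᵖ ⥤ 𝒞 ⥤ AddCommGrpCat.{w}) {C C' A : 𝒞} (c : C' ⟶ C) :
    Ext E C A →+ Ext E C' A :=
  ((E.map c.op).app A).hom

/-- `(a, c)` is a morphism of extensions `δ → ρ`, i.e. `a_* δ = c^* ρ`. -/
def IsExtHom (E : 𝒞ᵒᵖ ⥤ 𝒞 ⥤ AddCommGrpCat.{w}) {A C B D : 𝒞}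
    (δ : Ext E C A) (ρ : Ext E D B) (a : A ⟶ B) (c : C ⟶ D) : Prop :=
  push E a δ = pull E c ρ

/-- `E` is biadditive: additive in each of its two variables. -/
structure IsBiadditive [Preadditive 𝒞] (E : 𝒞ᵒᵖ ⥤ 𝒞 ⥤ AddCommGrpCat.{w}) : Prop where
  covariant : ∀ C : 𝒞ᵒᵖ, (E.obj C).Additive
  contravariant : ∀ A : 𝒞, (E.flip.obj A).Additive

/-- The direct sum `δ ⊕ ρ ∈ E(C ⊕ D, A ⊕ B)` of two extensions: the element with components
`(δ, 0, 0, ρ)` (see `sumExt_components` and `eq_sumExt`). -/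
noncomputable def sumExt [Preadditive 𝒞] [HasBinaryBiproducts 𝒞]
    (E : 𝒞ᵒᵖ ⥤ 𝒞 ⥤ AddCommGrpCat.{w}) {A C B D : 𝒞}
    (δ : Ext E C A) (ρ : Ext E D B) : Ext E (C ⊞ D) (A ⊞ B) :=
  push E biprod.inl (pull E biprod.fst δ) + push E biprod.inr (pull E biprod.snd ρ)

end Extensions

section ExtensionFacts

variable {𝒞 : Type u} [Category.{v} 𝒞] (E : 𝒞ᵒᵖ ⥤ 𝒞 ⥤ AddCommGrpCat.{w})

theorem push_id {C A : 𝒞} (δ : Ext E C A) : push E (𝟙 A) δ = δ := by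
  simp [push]

theorem pull_id {C A : 𝒞} (δ : Ext E C A) : pull E (𝟙 C) δ = δ := by
  simp [pull]

theorem push_comp {C A A' A'' : 𝒞} (a : A ⟶ A') (a' : A' ⟶ A'') (δ : Ext E C A) :
    push E (a ≫ a') δ = push E a' (push E a δ) := by
  simp [push]

theorem pull_comp {C C' C'' A : 𝒞} (c : C' ⟶ C) (c' : C'' ⟶ C') (δ : Ext E C A) :
    pull E (c' ≫ c) δ = pull E c' (pull E c δ) := by
  simp [pull]

theorem pull_push {C C' A A' : 𝒞} (c : C' ⟶ C) (a : A ⟶ A') (δ : Ext E C A) :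
    pull E c (push E a δ) = push E a (pull E c δ) := by
  exact ConcreteCategory.congr_hom ((E.map c.op).naturality a) δ

variable [Preadditive 𝒞] {E}

theorem IsBiadditive.push_add (hE : IsBiadditive E) {C A A' : 𝒞} (a a' : A ⟶ A')
    (δ : Ext E C A) : push E (a + a') δ = push E a δ + push E a' δ := by
  have := hE.covariant (op C)
  simp [push, Functor.map_add]

theorem IsBiadditive.pull_add (hE : IsBiadditive E) {C C' A : 𝒞} (c c' : C' ⟶ C)
    (δ : Ext E C A) : pull E (c + c') δ = pull E c δ + pull E c' δ := by
  have := hE.contravariant A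
  have h : (E.flip.obj A).map (c.op + c'.op) = _ := Functor.map_add (E.flip.obj A)
  exact ConcreteCategory.congr_hom h δ

theorem IsBiadditive.push_zero (hE : IsBiadditive E) {C A A' : 𝒞} (δ : Ext E C A) :
    push E (0 : A ⟶ A') δ = 0 := by
  simpa using hE.push_add (0 : A ⟶ A') 0 δ

theorem IsBiadditive.pull_zero (hE : IsBiadditive E) {C C' A : 𝒞} (δ : Ext E C A) :
    pull E (0 : C' ⟶ C) δ = 0 := by
  simpa using hE.pull_add (0 : C' ⟶ C) 0 δ

variable [HasBinaryBiproducts 𝒞] {A B C D : 𝒞}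

/-- The four components of `δ ⊕ ρ`. -/
theorem sumExt_components (hE : IsBiadditive E) (δ : Ext E C A) (ρ : Ext E D B) :
    push E biprod.fst (pull E biprod.inl (sumExt E δ ρ)) = δ ∧
    push E biprod.snd (pull E biprod.inl (sumExt E δ ρ)) = 0 ∧
    push E biprod.fst (pull E biprod.inr (sumExt E δ ρ)) = 0 ∧
    push E biprod.snd (pull E biprod.inr (sumExt E δ ρ)) = ρ := by
  refine ⟨?_, ?_, ?_, ?_⟩ <;>
    simp [sumExt, pull_push, ← push_comp, ← pull_comp, hE.push_zero, hE.pull_zero,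
      push_id, pull_id]

/-- An extension of `C ⊕ D` by `A ⊕ B` is determined by its four components. -/
theorem eq_sumExt (hE : IsBiadditive E) (δ : Ext E C A) (ρ : Ext E D B)
    (θ : Ext E (C ⊞ D) (A ⊞ B))
    (h₁ : push E biprod.fst (pull E biprod.inl θ) = δ)
    (h₂ : push E biprod.snd (pull E biprod.inl θ) = 0)
    (h₃ : push E biprod.fst (pull E biprod.inr θ) = 0)
    (h₄ : push E biprod.snd (pull E biprod.inr θ) = ρ) : θ = sumExt E δ ρ := by
  have key : ∀ X : 𝒞, ∀ η : Ext E X (A ⊞ B),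
      η = push E biprod.inl (push E biprod.fst η) + push E biprod.inr (push E biprod.snd η) := by
    intro X η
    rw [← push_comp, ← push_comp, ← hE.push_add, biprod.total, push_id]
  have e₁ : pull E biprod.inl θ = push E biprod.inl δ := by
    rw [key _ (pull E biprod.inl θ), h₁, h₂, map_zero, add_zero]
  have e₂ : pull E biprod.inr θ = push E biprod.inr ρ := by
    rw [key _ (pull E biprod.inr θ), h₃, h₄, map_zero, zero_add]
  have e : θ = pull E biprod.fst (pull E biprod.inl θ) + pull E biprod.snd (pull E biprod.inr θ) := by
    rw [← pull_comp, ← pull_comp, ← hE.pull_add, biprod.total, pull_id]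
  rw [e, e₁, e₂, pull_push, pull_push, sumExt]

end ExtensionFacts

/-! ### Three-term sequences -/

section Sequences

variable {𝒞 : Type u} [Category.{v} 𝒞]

/-- A sequence `A ⟶ mid ⟶ C` of two composable morphisms with fixed end terms. -/
structure Seq (A C : 𝒞) where
  mid : 𝒞
  i : A ⟶ mid
  p : mid ⟶ C

/-- `(a, b, c)` is a morphism of sequences `X → Y`. -/
structure IsSeqHom {A C A' C' : 𝒞} (X : Seq A C) (Y : Seq A' C')
    (a : A ⟶ A') (b : X.mid ⟶ Y.mid) (c : C ⟶ C') : Prop where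
  comm_i : X.i ≫ b = a ≫ Y.i
  comm_p : X.p ≫ c = b ≫ Y.p

/-- Equivalence of sequences with the same end terms: there is an isomorphism of the middle
terms compatible with the identities of the end terms. -/
def IsoEquiv {A C : 𝒞} (X Y : Seq A C) : Prop :=
  ∃ b : X.mid ≅ Y.mid, IsSeqHom X Y (𝟙 A) b.hom (𝟙 C)

/-- The equivalence class of `X` for `IsoEquiv`. -/
def isoClass {A C : 𝒞} (X : Seq A C) : Set (Seq A C) := {Y | IsoEquiv X Y}

variable [Preadditive 𝒞]

/-- The sequence is a complex (with terms in degrees `0, 1, 2`). -/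
def Seq.IsComplex {A C : 𝒞} (X : Seq A C) : Prop := X.i ≫ X.p = 0

/-- For morphisms `(𝟙 A, f, 𝟙 C)` and `(𝟙 A, g, 𝟙 C)` from `X` to `Y`: they are homotopic,
through a homotopy `(φ₁, φ₂)`. -/
def Homotopic {A C : 𝒞} (X Y : Seq A C) (f g : X.mid ⟶ Y.mid) : Prop :=
  ∃ (φ₁ : X.mid ⟶ A) (φ₂ : C ⟶ Y.mid),
    X.i ≫ φ₁ = 0 ∧ g - f = φ₁ ≫ Y.i + X.p ≫ φ₂ ∧ φ₂ ≫ Y.p = 0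

/-- Homotopy equivalence in the category of complexes `A ⟶ mid ⟶ C` with fixed end terms,
whose morphisms are the morphisms of complexes of the form `(𝟙 A, f, 𝟙 C)`. -/
def HtpyEquiv {A C : 𝒞} (X Y : Seq A C) : Prop :=
  ∃ (f : X.mid ⟶ Y.mid) (g : Y.mid ⟶ X.mid),
    IsSeqHom X Y (𝟙 A) f (𝟙 C) ∧ IsSeqHom Y X (𝟙 A) g (𝟙 C) ∧
    Homotopic X X (f ≫ g) (𝟙 X.mid) ∧ Homotopic Y Y (g ≫ f) (𝟙 Y.mid)

/-- The homotopy equivalence class of a complex `X`; its members are complexes. -/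
def htpyClass {A C : 𝒞} (X : Seq A C) : Set (Seq A C) := {Y | Y.IsComplex ∧ HtpyEquiv X Y}

variable [HasBinaryBiproducts 𝒞]

/-- The split sequence `A ⟶ A ⊕ C ⟶ C`. -/
noncomputable def splitSeq (A C : 𝒞) : Seq A C := ⟨A ⊞ C, biprod.inl, biprod.snd⟩

/-- The direct sum of two sequences. -/
noncomputable def sumSeq {A C A' C' : 𝒞} (X : Seq A C) (Y : Seq A' C') :
    Seq (A ⊞ A') (C ⊞ C') :=
  ⟨X.mid ⊞ Y.mid, biprod.map X.i Y.i, biprod.map X.p Y.p⟩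

/-- The mapping cone `X¹ ⟶ C ⊕ Y¹ ⟶ D` of a morphism `(𝟙 A, b, c) : X → Y`, with
differentials `(-d_X, b)` and `(c, d_Y)`. -/
noncomputable def cone {A C D : 𝒞} (X : Seq A C) (Y : Seq A D)
    (b : X.mid ⟶ Y.mid) (c : C ⟶ D) : Seq X.mid D :=
  ⟨C ⊞ Y.mid, biprod.lift (-X.p) b, biprod.desc c Y.p⟩

/-- The mapping cocone `A ⟶ B ⊕ X¹ ⟶ Y¹` of a morphism `(a, b, 𝟙 C) : X → Y`, with
differentials `(a, d_X)` and `(-d_Y, b)`. -/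
noncomputable def cocone {A B C : 𝒞} (X : Seq A C) (Y : Seq B C)
    (a : A ⟶ B) (b : X.mid ⟶ Y.mid) : Seq A Y.mid :=
  ⟨B ⊞ X.mid, biprod.lift a X.i, biprod.desc (-Y.i) b⟩

end Sequences

/-! ### Realizations -/

section Realizations

variable {𝒞 : Type u} [Category.{v} 𝒞] {E : 𝒞ᵒᵖ ⥤ 𝒞 ⥤ AddCommGrpCat.{w}}

/-- A correspondence `s` which associates with each extension `δ ∈ E(C, A)` a class of
sequences `A ⟶ B ⟶ C`. -/
abbrev Correspondence (E : 𝒞ᵒᵖ ⥤ 𝒞 ⥤ AddCommGrpCat.{w}) : Type (max u v w) :=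
  ∀ ⦃C A : 𝒞⦄, Ext E C A → Set (Seq A C)

/-- Every morphism of extensions lifts to a morphism between any sequences realizing them. -/
def LiftsMorphisms (s : Correspondence E) : Prop :=
  ∀ ⦃A C B D : 𝒞⦄ (δ : Ext E C A) (ρ : Ext E D B), ∀ X ∈ s δ, ∀ Y ∈ s ρ,
    ∀ (a : A ⟶ B) (c : C ⟶ D), IsExtHom E δ ρ a c →
      ∃ b : X.mid ⟶ Y.mid, IsSeqHom X Y a b c

variable [Preadditive 𝒞]

/-- The pair `⟨X, δ⟩` of a complex `X : X⁰ ⟶ X¹ ⟶ X²` and `δ ∈ E(X², X⁰)` is a `1`-exangle: the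
sequences `𝒞(Q, X⁰) → 𝒞(Q, X¹) → 𝒞(Q, X²) → E(Q, X⁰)` and
`𝒞(X², Q) → 𝒞(X¹, Q) → 𝒞(X⁰, Q) → E(X², Q)` are exact for every object `Q`. -/
structure IsExangle {A C : 𝒞} (X : Seq A C) (δ : Ext E C A) : Prop where
  isComplex : X.IsComplex
  exact_mid : ∀ Q : 𝒞, Function.Exact (fun f : Q ⟶ A => f ≫ X.i) (fun f : Q ⟶ X.mid => f ≫ X.p)
  exact_right : ∀ Q : 𝒞,
    Function.Exact (fun f : Q ⟶ X.mid => f ≫ X.p) (fun f : Q ⟶ C => pull E f δ)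
  coexact_mid : ∀ Q : 𝒞,
    Function.Exact (fun f : C ⟶ Q => X.p ≫ f) (fun f : X.mid ⟶ Q => X.i ≫ f)
  coexact_left : ∀ Q : 𝒞,
    Function.Exact (fun f : X.mid ⟶ Q => X.i ≫ f) (fun f : A ⟶ Q => push E f δ)

/-- `f` is an inflation: the first morphism of some sequence realizing an extension. -/
def IsInflation (s : Correspondence E) {A B : 𝒞} (f : A ⟶ B) : Prop :=
  ∃ (C : 𝒞) (p : B ⟶ C) (δ : Ext E C A), (⟨B, f, p⟩ : Seq A C) ∈ s δ

/-- `g` is a deflation: the last morphism of some sequence realizing an extension. -/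
def IsDeflation (s : Correspondence E) {B C : 𝒞} (g : B ⟶ C) : Prop :=
  ∃ (A : 𝒞) (i : A ⟶ B) (δ : Ext E C A), (⟨B, i, g⟩ : Seq A C) ∈ s δ

/-- `s` is an exact realization of `E` by homotopy equivalence classes of complexes
`A ⟶ B ⟶ C`. -/
structure IsExactRealization (s : Correspondence E) : Prop where
  class_eq : ∀ ⦃C A : 𝒞⦄ (δ : Ext E C A), ∃ X : Seq A C, X.IsComplex ∧ s δ = htpyClass X
  R0 : LiftsMorphisms s
  R1 : ∀ ⦃C A : 𝒞⦄ (δ : Ext E C A), ∀ X ∈ s δ, IsExangle X δ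
  R2 : ∀ (A Z : 𝒞), IsZero Z → s (0 : Ext E Z A) = htpyClass ⟨A, 𝟙 A, 0⟩
  R2_op : ∀ (A Z : 𝒞), IsZero Z → s (0 : Ext E A Z) = htpyClass ⟨A, 0, 𝟙 A⟩

variable [HasBinaryBiproducts 𝒞]

/-- `(𝒞, E, s)` is a `1`-exangulated category, for `𝒞` additive and `E` biadditive. -/
structure IsOneExangulated (s : Correspondence E) : Prop extends IsExactRealization s where
  EA1 : ∀ ⦃A B C : 𝒞⦄ (f : A ⟶ B) (g : B ⟶ C),
    IsInflation s f → IsInflation s g → IsInflation s (f ≫ g)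
  EA1_op : ∀ ⦃A B C : 𝒞⦄ (f : A ⟶ B) (g : B ⟶ C),
    IsDeflation s f → IsDeflation s g → IsDeflation s (f ≫ g)
  EA2 : ∀ ⦃A C D : 𝒞⦄ (ρ : Ext E D A) (c : C ⟶ D), ∀ X ∈ s (pull E c ρ), ∀ Y ∈ s ρ,
    ∃ b : X.mid ⟶ Y.mid, IsSeqHom X Y (𝟙 A) b c ∧ cone X Y b c ∈ s (push E X.i ρ)
  EA2_op : ∀ ⦃A B C : 𝒞⦄ (δ : Ext E C A) (a : A ⟶ B), ∀ X ∈ s δ, ∀ Y ∈ s (push E a δ),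
    ∃ b : X.mid ⟶ Y.mid, IsSeqHom X Y a b (𝟙 C) ∧ cocone X Y a b ∈ s (pull E Y.p δ)

/-- `s` is an additive realization of `E` by equivalence classes of sequences `A ⟶ B ⟶ C`. -/
structure IsAdditiveRealization (s : Correspondence E) : Prop where
  class_eq : ∀ ⦃C A : 𝒞⦄ (δ : Ext E C A), ∃ X : Seq A C, s δ = isoClass X
  lifts : LiftsMorphisms s
  split : ∀ A C : 𝒞, s (0 : Ext E C A) = isoClass (splitSeq A C)
  sum : ∀ ⦃A C B D : 𝒞⦄ (δ : Ext E C A) (ρ : Ext E D B), ∀ X ∈ s δ, ∀ Y ∈ s ρ,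
    s (sumExt E δ ρ) = isoClass (sumSeq X Y)

/-- `(𝒞, E, s)` is an extriangulated category, for `𝒞` additive and `E` biadditive. -/
structure IsExtriangulated (s : Correspondence E) : Prop where
  ET1 : IsBiadditive E
  ET2 : IsAdditiveRealization s
  ET3 : ∀ ⦃A C A' C' : 𝒞⦄ (δ : Ext E C A) (δ' : Ext E C' A'), ∀ X ∈ s δ, ∀ X' ∈ s δ',
    ∀ (a : A ⟶ A') (b : X.mid ⟶ X'.mid), X.i ≫ b = a ≫ X'.i →
      ∃ c : C ⟶ C', IsExtHom E δ δ' a c ∧ X.p ≫ c = b ≫ X'.p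
  ET3_op : ∀ ⦃A C A' C' : 𝒞⦄ (δ : Ext E C A) (δ' : Ext E C' A'), ∀ X ∈ s δ, ∀ X' ∈ s δ',
    ∀ (b : X.mid ⟶ X'.mid) (c : C ⟶ C'), X.p ≫ c = b ≫ X'.p →
      ∃ a : A ⟶ A', IsExtHom E δ δ' a c ∧ X.i ≫ b = a ≫ X'.i
  ET4 : ∀ ⦃A B C D F : 𝒞⦄ (f : A ⟶ B) (f' : B ⟶ D) (g : B ⟶ C) (g' : C ⟶ F)
    (δ : Ext E D A) (δ' : Ext E F B),
    (⟨B, f, f'⟩ : Seq A D) ∈ s δ → (⟨C, g, g'⟩ : Seq B F) ∈ s δ' →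
      ∃ (G : 𝒞) (h' : C ⟶ G) (d : D ⟶ G) (e : G ⟶ F) (δ'' : Ext E G A),
        f' ≫ d = g ≫ h' ∧ h' ≫ e = g' ∧
        (⟨C, f ≫ g, h'⟩ : Seq A G) ∈ s δ'' ∧
        (⟨G, d, e⟩ : Seq D F) ∈ s (push E f' δ') ∧
        pull E d δ'' = δ ∧
        push E f δ'' = pull E e δ'
  ET4_op : ∀ ⦃A B C D F : 𝒞⦄ (f' : D ⟶ A) (f : A ⟶ B) (g' : F ⟶ B) (g : B ⟶ C)
    (δ : Ext E B D) (δ' : Ext E C F),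
    (⟨A, f', f⟩ : Seq D B) ∈ s δ → (⟨B, g', g⟩ : Seq F C) ∈ s δ' →
      ∃ (G : 𝒞) (h' : G ⟶ A) (d : D ⟶ G) (e : G ⟶ F) (δ'' : Ext E C G),
        d ≫ h' = f' ∧ h' ≫ f = e ≫ g' ∧
        (⟨A, h', f ≫ g⟩ : Seq G C) ∈ s δ'' ∧
        (⟨G, d, e⟩ : Seq D F) ∈ s (pull E g' δ) ∧
        push E e δ'' = δ' ∧
        push E d δ = pull E g δ''

end Realizations

end Exangulated

/-!
An extension `δ` together with a realizing sequence is an exangle: two long exact sequences, one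
covariant and one contravariant. The five lemma for exangles (`IsExangle.isIso_mid`) shows that a
morphism of exangles which is invertible at the end terms is invertible in the middle. Hence
homotopy classes and isomorphism classes of realizing sequences agree
(`IsExangle.htpyClass_eq_isoClass`), and a realization is recognized by comparing it with any
realization of the same extension. This gives the split sequences and the direct sums of (ET2).

For a `1`-exangulated category, the crucial case of (ET3) is that of `a = 𝟙`
(`IsOneExangulated.exists_right`): given sequences realizing `δ ∈ E(C, A)` and `δ' ∈ E(C', A)`, the
first of which maps to the second over `𝟙 A`, the extension of `C ⊞ C'` with components `δ` and
`δ'` is killed by the second inflation. So the cone of (EA2) for `biprod.inr : C' ⟶ C ⊞ C'` splits,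
and a splitting yields `c : C ⟶ C'` with `c^* δ' = δ`. The general case follows by means of
(EA2ᵒᵖ). If the map of middle terms is invertible, then so is `c`, since an endomorphism of an
exangle which is the identity on the first two terms is unipotent on the third
(`IsExangle.isIso_of_p_comp`). In (ET4) the composite of two inflations is an inflation by (EA1),
and its last term is identified with the object of a realization of `f'_* δ'` by comparing the cone
of (EA2) with the cocone of (EA2ᵒᵖ), which have the same inflation up to a shear
(`IsOneExangulated.octahedron`).

For an extriangulated category, the exact sequences come from (ET3) and (ET3ᵒᵖ) applied to the
trivial sequences `Q ⟶ Q ⟶ 0` and `0 ⟶ Q ⟶ Q`, and (EA1) is contained in (ET4). For (EA2), the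
deflation `C ⊞ Y¹ ⟶ D` of the cone is written as a composite `C ⊞ Y¹ ⟶ C ⊞ D ⟶ D` of two deflations,
to which (ET4ᵒᵖ) applies (`IsExtriangulated.exists_cone_mem`).

The dual halves are proved by reversing the arrows in the arguments.
-/

namespace Exangulated

/-! ### Arithmetic of extensions -/

section Arithmetic

variable {𝒞 : Type u} [Category.{v} 𝒞] [Preadditive 𝒞] {E : 𝒞ᵒᵖ ⥤ 𝒞 ⥤ AddCommGrpCat.{w}}

theorem IsBiadditive.push_sub (hE : IsBiadditive E) {C A A' : 𝒞} (a a' : A ⟶ A')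
    (δ : Ext E C A) : push E (a - a') δ = push E a δ - push E a' δ := by
  rw [eq_sub_iff_add_eq, ← hE.push_add, sub_add_cancel]

theorem IsBiadditive.pull_sub (hE : IsBiadditive E) {C C' A : 𝒞} (c c' : C' ⟶ C)
    (δ : Ext E C A) : pull E (c - c') δ = pull E c δ - pull E c' δ := by
  rw [eq_sub_iff_add_eq, ← hE.pull_add, sub_add_cancel]

variable [HasBinaryBiproducts 𝒞] {A B C D : 𝒞}

theorem push_fst_sumExt (hE : IsBiadditive E) (δ : Ext E C A) (ρ : Ext E D B) :
    push E biprod.fst (sumExt E δ ρ) = pull E biprod.fst δ := by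
  simp [sumExt, ← push_comp, hE.push_zero, push_id]

theorem push_snd_sumExt (hE : IsBiadditive E) (δ : Ext E C A) (ρ : Ext E D B) :
    push E biprod.snd (sumExt E δ ρ) = pull E biprod.snd ρ := by
  simp [sumExt, ← push_comp, hE.push_zero, push_id]

theorem pull_inl_sumExt (hE : IsBiadditive E) (δ : Ext E C A) (ρ : Ext E D B) :
    pull E biprod.inl (sumExt E δ ρ) = push E biprod.inl δ := by
  simp [sumExt, pull_push, ← pull_comp, hE.pull_zero, pull_id]

theorem pull_inr_sumExt (hE : IsBiadditive E) (δ : Ext E C A) (ρ : Ext E D B) :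
    pull E biprod.inr (sumExt E δ ρ) = push E biprod.inr ρ := by
  simp [sumExt, pull_push, ← pull_comp, hE.pull_zero, pull_id]

end Arithmetic

/-! ### Isomorphisms of sequences -/

section IsoClasses

variable {𝒞 : Type u} [Category.{v} 𝒞] {A C : 𝒞} {X Y : Seq A C}

theorem IsoEquiv.symm (h : IsoEquiv X Y) : IsoEquiv Y X := by
  obtain ⟨b, hb⟩ := h
  have h₁ := hb.comm_i
  have h₂ := hb.comm_p
  exact ⟨b.symm, ⟨by simp [← Iso.eq_comp_inv] at h₁ ⊢; exact h₁.symm,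
    by simp at h₂ ⊢; simp [h₂]⟩⟩

theorem IsoEquiv.trans {Z : Seq A C} (h : IsoEquiv X Y) (h' : IsoEquiv Y Z) : IsoEquiv X Z := by
  obtain ⟨b, hb⟩ := h
  obtain ⟨b', hb'⟩ := h'
  refine ⟨b ≪≫ b', ?_, ?_⟩
  · have := hb'.comm_i
    simp [reassoc_of% hb.comm_i, this]
  · have := hb.comm_p
    simp at this
    simp [← hb'.comm_p, this]

theorem isoClass_eq_of_mem (h : Y ∈ isoClass X) : isoClass X = isoClass Y :=
  Set.ext fun _ => ⟨fun h' => (IsoEquiv.symm h).trans h', fun h' => IsoEquiv.trans h h'⟩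

theorem self_mem_isoClass (X : Seq A C) : X ∈ isoClass X := ⟨Iso.refl _, by simp, by simp⟩

theorem isIso_of_isIso_comp {P Q : 𝒞} (c : P ⟶ Q) (c' : Q ⟶ P) [IsIso (c ≫ c')]
    [IsIso (c' ≫ c)] : IsIso c := by
  have : IsSplitEpi c := ⟨⟨inv (c' ≫ c) ≫ c', by simp⟩⟩
  have : Mono c := mono_of_mono c c'
  exact isIso_of_mono_of_isSplitEpi c

end IsoClasses

/-! ### Exangles -/

section Exangles

variable {𝒞 : Type u} [Category.{v} 𝒞] [Preadditive 𝒞] {E : 𝒞ᵒᵖ ⥤ 𝒞 ⥤ AddCommGrpCat.{w}}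
  {A C A' C' Q : 𝒞} {X Y : Seq A C} {X' : Seq A' C'} {δ : Ext E C A} {δ' : Ext E C' A'}

namespace IsExangle

theorem comp_p_eq_zero_imp (h : IsExangle X δ) (f : Q ⟶ X.mid) (hf : f ≫ X.p = 0) :
    ∃ g : Q ⟶ A, g ≫ X.i = f :=
  (h.exact_mid Q f).1 hf

theorem i_comp_eq_zero_imp (h : IsExangle X δ) (f : X.mid ⟶ Q) (hf : X.i ≫ f = 0) :
    ∃ g : C ⟶ Q, X.p ≫ g = f :=
  (h.coexact_mid Q f).1 hf

theorem pull_eq_zero_imp (h : IsExangle X δ) (f : Q ⟶ C) (hf : pull E f δ = 0) :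
    ∃ g : Q ⟶ X.mid, g ≫ X.p = f :=
  (h.exact_right Q f).1 hf

theorem push_eq_zero_imp (h : IsExangle X δ) (f : A ⟶ Q) (hf : push E f δ = 0) :
    ∃ g : X.mid ⟶ Q, X.i ≫ g = f :=
  (h.coexact_left Q f).1 hf

theorem pull_p (h : IsExangle X δ) : pull E X.p δ = 0 :=
  (h.exact_right _ X.p).2 ⟨𝟙 _, Category.id_comp _⟩

theorem push_i (h : IsExangle X δ) : push E X.i δ = 0 :=
  (h.coexact_left _ X.i).2 ⟨𝟙 _, Category.comp_id _⟩

/-- The four exactness conditions, with the easy inclusions reduced to the universal case. -/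
theorem of_lifts (h₀ : X.IsComplex) (hp : pull E X.p δ = 0) (hi : push E X.i δ = 0)
    (h₁ : ∀ (Q : 𝒞) (f : Q ⟶ X.mid), f ≫ X.p = 0 → ∃ g : Q ⟶ A, g ≫ X.i = f)
    (h₂ : ∀ (Q : 𝒞) (f : Q ⟶ C), pull E f δ = 0 → ∃ g : Q ⟶ X.mid, g ≫ X.p = f)
    (h₃ : ∀ (Q : 𝒞) (f : X.mid ⟶ Q), X.i ≫ f = 0 → ∃ g : C ⟶ Q, X.p ≫ g = f)
    (h₄ : ∀ (Q : 𝒞) (f : A ⟶ Q), push E f δ = 0 → ∃ g : X.mid ⟶ Q, X.i ≫ g = f) :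
    IsExangle X δ where
  isComplex := h₀
  exact_mid Q f := by
    refine ⟨h₁ Q f, ?_⟩
    rintro ⟨g, rfl⟩
    simp [show X.i ≫ X.p = 0 from h₀]
  exact_right Q f := by
    refine ⟨h₂ Q f, ?_⟩
    rintro ⟨g, rfl⟩
    simp [pull_comp, hp]
  coexact_mid Q f := by
    refine ⟨h₃ Q f, ?_⟩
    rintro ⟨g, rfl⟩
    simp [reassoc_of% (show X.i ≫ X.p = 0 from h₀)]
  coexact_left Q f := by
    refine ⟨h₄ Q f, ?_⟩
    rintro ⟨g, rfl⟩
    simp [push_comp, hi]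

/-- The five lemma for exangles. Although the first morphism of an exangle need not be a
monomorphism, exactness of the covariant sequences makes `b` a split epimorphism, and exactness
of the contravariant ones makes it a split monomorphism. -/
theorem isIso_mid (hX : IsExangle X δ) (hX' : IsExangle X' δ') {a : A ⟶ A'} {c : C ⟶ C'}
    [IsIso a] [IsIso c] (hac : IsExtHom E δ δ' a c) {b : X.mid ⟶ X'.mid}
    (hb : IsSeqHom X X' a b c) : IsIso b := by
  have hsec : ∃ t : X'.mid ⟶ X.mid, t ≫ b = 𝟙 _ := by
    have h₀ : pull E (X'.p ≫ inv c) δ = 0 := by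
      have e : push E a (pull E (X'.p ≫ inv c) δ) = 0 := by
        rw [← pull_push, show push E a δ = _ from hac, ← pull_comp]
        simp [hX'.pull_p]
      rw [← push_id E (pull E (X'.p ≫ inv c) δ), ← IsIso.hom_inv_id a, push_comp, e, map_zero]
    obtain ⟨x, hx⟩ := hX.pull_eq_zero_imp _ h₀
    obtain ⟨y, hy⟩ := hX'.comp_p_eq_zero_imp (𝟙 _ - x ≫ b) (by
      simp [← hb.comm_p, reassoc_of% hx])
    refine ⟨x + y ≫ inv a ≫ X.i, ?_⟩
    simp [hb.comm_i, hy]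
  have hret : ∃ r : X'.mid ⟶ X.mid, b ≫ r = 𝟙 _ := by
    have h₀ : push E (inv a ≫ X.i) δ' = 0 := by
      have e : pull E c (push E (inv a ≫ X.i) δ') = 0 := by
        rw [pull_push, ← show push E a δ = _ from hac, ← push_comp]
        simp [hX.push_i]
      rw [← pull_id E (push E (inv a ≫ X.i) δ'), ← IsIso.inv_hom_id c, pull_comp, e, map_zero]
    obtain ⟨x, hx⟩ := hX'.push_eq_zero_imp _ h₀
    obtain ⟨y, hy⟩ := hX.i_comp_eq_zero_imp (𝟙 _ - b ≫ x) (by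
      simp [reassoc_of% hb.comm_i, hx])
    refine ⟨x + X'.p ≫ inv c ≫ y, ?_⟩
    simp [← reassoc_of% hb.comm_p, hy]
  obtain ⟨t, ht⟩ := hsec
  obtain ⟨r, hr⟩ := hret
  have e : r = t := by
    rw [← Category.id_comp r, ← ht, Category.assoc, hr, Category.comp_id]
  exact ⟨r, hr, e ▸ ht⟩

/-- An endomorphism `k` of the last term of an exangle which fixes both the last morphism and the
extension is invertible, because `(k - 1)² = 0`. -/
theorem isIso_of_p_comp (hE : IsBiadditive E) (hX : IsExangle X δ) (k : C ⟶ C)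
    (h₁ : X.p ≫ k = X.p) (h₂ : pull E k δ = δ) : IsIso k := by
  obtain ⟨y, hy⟩ := hX.pull_eq_zero_imp (k - 𝟙 C) (by rw [hE.pull_sub, pull_id, h₂, sub_self])
  have hsq : (k - 𝟙 C) ≫ (k - 𝟙 C) = 0 := by
    nth_rewrite 1 [← hy]
    simp [h₁]
  have hk : k ≫ k = k + k - 𝟙 C := by
    simp only [Preadditive.sub_comp, Preadditive.comp_sub, Category.comp_id,
      Category.id_comp] at hsq
    rw [← sub_eq_zero, ← hsq]
    abel
  exact ⟨𝟙 C + 𝟙 C - k, by simp [hk], by simp [hk]⟩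

theorem isIso_of_comp_i (hE : IsBiadditive E) (hX : IsExangle X δ) (k : A ⟶ A)
    (h₁ : k ≫ X.i = X.i) (h₂ : push E k δ = δ) : IsIso k := by
  obtain ⟨y, hy⟩ := hX.push_eq_zero_imp (k - 𝟙 A) (by rw [hE.push_sub, push_id, h₂, sub_self])
  have hsq : (k - 𝟙 A) ≫ (k - 𝟙 A) = 0 := by
    nth_rewrite 2 [← hy]
    simp [reassoc_of% h₁]
  have hk : k ≫ k = k + k - 𝟙 A := by
    simp only [Preadditive.sub_comp, Preadditive.comp_sub, Category.comp_id,
      Category.id_comp] at hsq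
    rw [← sub_eq_zero, ← hsq]
    abel
  exact ⟨𝟙 A + 𝟙 A - k, by simp [hk], by simp [hk]⟩

theorem of_htpyEquiv (hX : IsExangle X δ) (hY : Y.IsComplex) (hXY : HtpyEquiv X Y) :
    IsExangle Y δ := by
  obtain ⟨f, g, hf, hg, -, ψ₁, ψ₂, -, hψ, -⟩ := hXY
  have fi : X.i ≫ f = Y.i := by simpa using hf.comm_i
  have fp : f ≫ Y.p = X.p := by simpa using hf.comm_p.symm
  have gi : Y.i ≫ g = X.i := by simpa using hg.comm_i
  have gp : g ≫ X.p = Y.p := by simpa using hg.comm_p.symm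
  refine of_lifts hY ?_ ?_ ?_ ?_ ?_ ?_
  · rw [← gp, pull_comp, hX.pull_p, map_zero]
  · rw [← fi, push_comp, hX.push_i, map_zero]
  · intro Q u hu
    obtain ⟨x, hx⟩ := hX.comp_p_eq_zero_imp (u ≫ g) (by rw [Category.assoc, gp, hu])
    refine ⟨u ≫ ψ₁ + x, ?_⟩
    have := u ≫= hψ
    simp only [Preadditive.comp_sub, Preadditive.comp_add, reassoc_of% hu, zero_comp,
      Category.comp_id, add_zero, ← reassoc_of% hx, fi] at this
    simp [← this]
  · intro Q u hu
    obtain ⟨x, hx⟩ := hX.pull_eq_zero_imp u hu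
    exact ⟨x ≫ f, by rw [Category.assoc, fp, hx]⟩
  · intro Q u hu
    obtain ⟨x, hx⟩ := hX.i_comp_eq_zero_imp (f ≫ u) (by rw [reassoc_of% fi, hu])
    refine ⟨ψ₂ ≫ u + x, ?_⟩
    have := hψ =≫ u
    simp only [Preadditive.sub_comp, Preadditive.add_comp, Category.assoc, hu, comp_zero,
      Category.id_comp, zero_add, ← hx, reassoc_of% gp] at this
    simp [← this]
  · intro Q u hu
    obtain ⟨x, hx⟩ := hX.push_eq_zero_imp u hu
    exact ⟨g ≫ x, by rw [reassoc_of% gi, hx]⟩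

/-- For exangles, homotopy equivalence with fixed end terms is the same as isomorphism. -/
theorem htpyClass_eq_isoClass (hX : IsExangle X δ) : htpyClass X = isoClass X := by
  ext Y
  constructor
  · rintro ⟨hY, hXY⟩
    have hY' := hX.of_htpyEquiv hY hXY
    obtain ⟨f, -, hf, -⟩ := hXY
    have : IsIso f := hX.isIso_mid hY' (show push E (𝟙 A) δ = pull E (𝟙 C) δ by
      rw [push_id, pull_id]) hf
    exact ⟨asIso f, hf⟩
  · rintro ⟨f, hf⟩
    have fi : X.i ≫ f.hom = Y.i := by simpa using hf.comm_i
    have fp : f.hom ≫ Y.p = X.p := by simpa using hf.comm_p.symm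
    refine ⟨?_, f.hom, f.inv, hf, ⟨?_, ?_⟩, ⟨0, 0, ?_⟩, ⟨0, 0, ?_⟩⟩
    · rw [Seq.IsComplex, ← fi, Category.assoc, fp]
      exact hX.isComplex
    · simp [← fi]
    · simp [← fp]
    · simp
    · simp

end IsExangle

section Biproducts

variable [HasBinaryBiproducts 𝒞]

theorem isExangle_splitSeq (A C : 𝒞) (E : 𝒞ᵒᵖ ⥤ 𝒞 ⥤ AddCommGrpCat.{w}) :
    IsExangle (splitSeq A C) (0 : Ext E C A) := by
  refine .of_lifts (by simp [Seq.IsComplex, splitSeq]) (by simp) (by simp) ?_ ?_ ?_ ?_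
  · intro Q f hf
    exact ⟨f ≫ biprod.fst, by apply biprod.hom_ext <;> simp [splitSeq] at hf ⊢; exact hf.symm⟩
  · intro Q f _
    exact ⟨f ≫ biprod.inr, by simp [splitSeq]⟩
  · intro Q f hf
    exact ⟨biprod.inr ≫ f, by apply biprod.hom_ext' <;> simp [splitSeq] at hf ⊢; exact hf.symm⟩
  · intro Q f _
    exact ⟨biprod.fst ≫ f, by simp [splitSeq]⟩

theorem IsExangle.sum (hE : IsBiadditive E) (h : IsExangle X δ) (h' : IsExangle X' δ') :
    IsExangle (sumSeq X X') (sumExt E δ δ') := by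
  refine .of_lifts ?_ ?_ ?_ ?_ ?_ ?_ ?_
  · have h₁ : X.i ≫ X.p = 0 := h.isComplex
    have h₂ : X'.i ≫ X'.p = 0 := h'.isComplex
    apply biprod.hom_ext' <;> simp [sumSeq, reassoc_of% h₁, reassoc_of% h₂]
  · change pull E (biprod.map X.p X'.p) (sumExt E δ δ') = 0
    rw [sumExt, map_add, pull_push, pull_push, ← pull_comp, ← pull_comp, biprod.map_fst,
      biprod.map_snd, pull_comp, pull_comp, h.pull_p, h'.pull_p]
    simp
  · change push E (biprod.map X.i X'.i) (sumExt E δ δ') = 0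
    rw [sumExt, map_add, ← push_comp, ← push_comp, biprod.inl_map, biprod.inr_map, push_comp,
      push_comp, ← pull_push _ _ X.i, ← pull_push _ _ X'.i, h.push_i, h'.push_i]
    simp
  · intro Q (f : Q ⟶ X.mid ⊞ X'.mid) (hf : f ≫ biprod.map X.p X'.p = 0)
    obtain ⟨x, hx⟩ := h.comp_p_eq_zero_imp (f ≫ biprod.fst) (by
      simpa using hf =≫ biprod.fst)
    obtain ⟨y, hy⟩ := h'.comp_p_eq_zero_imp (f ≫ biprod.snd) (by
      simpa using hf =≫ biprod.snd)
    exact ⟨biprod.lift x y, by apply biprod.hom_ext <;> simp [sumSeq, hx, hy]⟩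
  · intro Q f hf
    obtain ⟨x, hx⟩ := h.pull_eq_zero_imp (f ≫ biprod.fst) (by
      rw [pull_comp, ← push_fst_sumExt hE δ δ', pull_push, hf, map_zero])
    obtain ⟨y, hy⟩ := h'.pull_eq_zero_imp (f ≫ biprod.snd) (by
      rw [pull_comp, ← push_snd_sumExt hE δ δ', pull_push, hf, map_zero])
    exact ⟨biprod.lift x y, by apply biprod.hom_ext <;> simp [sumSeq, hx, hy]⟩
  · intro Q (f : X.mid ⊞ X'.mid ⟶ Q) (hf : biprod.map X.i X'.i ≫ f = 0)
    obtain ⟨x, hx⟩ := h.i_comp_eq_zero_imp (biprod.inl ≫ f) (by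
      simpa using biprod.inl ≫= hf)
    obtain ⟨y, hy⟩ := h'.i_comp_eq_zero_imp (biprod.inr ≫ f) (by
      simpa using biprod.inr ≫= hf)
    exact ⟨biprod.desc x y, by apply biprod.hom_ext' <;> simp [sumSeq, hx, hy]⟩
  · intro Q f hf
    obtain ⟨x, hx⟩ := h.push_eq_zero_imp (biprod.inl ≫ f) (by
      rw [push_comp, ← pull_inl_sumExt hE δ δ', ← pull_push, hf, map_zero])
    obtain ⟨y, hy⟩ := h'.push_eq_zero_imp (biprod.inr ≫ f) (by
      rw [push_comp, ← pull_inr_sumExt hE δ δ', ← pull_push, hf, map_zero])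
    exact ⟨biprod.desc x y, by apply biprod.hom_ext' <;> simp [sumSeq, hx, hy]⟩

end Biproducts

end Exangles

/-! ### Exact realizations -/

section ExactRealizations

variable {𝒞 : Type u} [Category.{v} 𝒞] [Preadditive 𝒞] {E : 𝒞ᵒᵖ ⥤ 𝒞 ⥤ AddCommGrpCat.{w}}
  {s : Correspondence E} {A C A' C' : 𝒞}

namespace IsExactRealization

theorem eq_isoClass (h : IsExactRealization s) {δ : Ext E C A} {X : Seq A C} (hX : X ∈ s δ) :
    s δ = isoClass X := by
  obtain ⟨Y, hY, e⟩ := h.class_eq δ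
  have hYs : Y ∈ s δ := by
    rw [e]
    refine ⟨hY, 𝟙 _, 𝟙 _, ⟨by simp, by simp⟩, ⟨by simp, by simp⟩, ⟨0, 0, by simp⟩, ⟨0, 0, by simp⟩⟩
  rw [(h.R1 δ Y hYs).htpyClass_eq_isoClass] at e
  rw [e]
  exact isoClass_eq_of_mem (e ▸ hX)

theorem exists_mem (h : IsExactRealization s) (δ : Ext E C A) : ∃ X, X ∈ s δ := by
  obtain ⟨X, hX, e⟩ := h.class_eq δ
  exact ⟨X, e ▸ ⟨hX, 𝟙 _, 𝟙 _, ⟨by simp, by simp⟩, ⟨by simp, by simp⟩, ⟨0, 0, by simp⟩,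
    ⟨0, 0, by simp⟩⟩⟩

theorem mem_of_exangle (h : IsExactRealization s) {δ : Ext E C A} {X Y : Seq A C}
    (hX : X ∈ s δ) (hY : IsExangle Y δ) (b : X.mid ⟶ Y.mid) (hi : X.i ≫ b = Y.i)
    (hp : b ≫ Y.p = X.p) : Y ∈ s δ := by
  have hb : IsSeqHom X Y (𝟙 A) b (𝟙 C) := ⟨by simp [hi], by simp [hp]⟩
  have : IsIso b := (h.R1 δ X hX).isIso_mid hY (show push E (𝟙 A) δ = pull E (𝟙 C) δ by
    rw [push_id, pull_id]) hb
  rw [h.eq_isoClass hX]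
  exact ⟨asIso b, hb⟩

/-- Realizing sequences are stable under isomorphisms which also move the end terms. -/
theorem mem_of_iso (h : IsExactRealization s) {δ : Ext E C A} {δ' : Ext E C' A'} {X : Seq A C}
    {X' : Seq A' C'} (hX : X ∈ s δ) (a : A ≅ A') (b : X.mid ≅ X'.mid) (c : C ≅ C')
    (hac : IsExtHom E δ δ' a.hom c.hom) (hi : X.i ≫ b.hom = a.hom ≫ X'.i)
    (hp : X.p ≫ c.hom = b.hom ≫ X'.p) : X' ∈ s δ' := by
  obtain ⟨Y, hY⟩ := h.exists_mem δ'
  obtain ⟨y, hy⟩ := h.R0 δ δ' X hX Y hY _ _ hac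
  have : IsIso y := (h.R1 δ X hX).isIso_mid (h.R1 δ' Y hY) hac hy
  rw [h.eq_isoClass hY]
  refine ⟨(asIso y).symm ≪≫ b, ?_, ?_⟩
  · have := hy.comm_i
    rw [← Iso.inv_comp_eq] at this
    simp [← this, hi]
  · have := hy.comm_p
    simp [← hp, this]

end IsExactRealization

end ExactRealizations

/-! ### From `1`-exangulated to extriangulated -/

section OneExangulated

variable {𝒞 : Type u} [Category.{v} 𝒞] [Preadditive 𝒞] [HasBinaryBiproducts 𝒞]
  {E : 𝒞ᵒᵖ ⥤ 𝒞 ⥤ AddCommGrpCat.{w}} {s : Correspondence E} {A B C D F A' C' : 𝒞}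

theorem IsExactRealization.isAdditiveRealization (hE : IsBiadditive E)
    (h : IsExactRealization s) : IsAdditiveRealization s where
  class_eq C A δ := by
    obtain ⟨X, hX⟩ := h.exists_mem δ
    exact ⟨X, h.eq_isoClass hX⟩
  lifts := h.R0
  split A C := by
    obtain ⟨X, hX⟩ := h.exists_mem (0 : Ext E C A)
    have hX' := h.R1 _ X hX
    obtain ⟨r, hr⟩ := hX'.push_eq_zero_imp (𝟙 A) (map_zero _)
    exact h.eq_isoClass (h.mem_of_exangle hX (isExangle_splitSeq A C E) (biprod.lift r X.p)
      (by
        have : X.i ≫ X.p = 0 := hX'.isComplex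
        apply biprod.hom_ext <;> simp [splitSeq, hr, this])
      (by simp [splitSeq]))
  sum A C B D δ ρ X hX Y hY := by
    obtain ⟨Z, hZ⟩ := h.exists_mem (sumExt E δ ρ)
    obtain ⟨x, hx⟩ := h.R0 δ _ X hX Z hZ biprod.inl biprod.inl (pull_inl_sumExt hE δ ρ).symm
    obtain ⟨y, hy⟩ := h.R0 ρ _ Y hY Z hZ biprod.inr biprod.inr (pull_inr_sumExt hE δ ρ).symm
    let z : (sumSeq X Y).mid ⟶ Z.mid := (biprod.desc x y : X.mid ⊞ Y.mid ⟶ Z.mid)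
    have hz : IsSeqHom (sumSeq X Y) Z (𝟙 _) z (𝟙 _) := by
      constructor
      · apply biprod.hom_ext' <;> simp [sumSeq, z, hx.comm_i, hy.comm_i]
      · apply biprod.hom_ext' <;> simp [sumSeq, z, ← hx.comm_p, ← hy.comm_p]
    have : IsIso z := ((h.R1 δ X hX).sum hE (h.R1 ρ Y hY)).isIso_mid (h.R1 _ Z hZ)
      (show push E (𝟙 _) (sumExt E δ ρ) = pull E (𝟙 _) (sumExt E δ ρ) by
        rw [push_id, pull_id]) hz
    exact h.eq_isoClass (by
      rw [h.eq_isoClass hZ]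
      exact IsoEquiv.symm ⟨asIso z, hz⟩)

namespace IsOneExangulated

/-- The case `a = 𝟙` of (ET3). The extension `ρ` of `C ⊞ C'` with components `δ` and `δ'` pushes
forward to zero along the inflation of `X'`, so the cone which (EA2) attaches to `biprod.inr`, and
which realizes this push-forward, splits. -/
theorem exists_right (hE : IsBiadditive E) (h : IsOneExangulated s) {δ : Ext E C A}
    {δ' : Ext E C' A} {X : Seq A C} (hX : X ∈ s δ) {X' : Seq A C'} (hX' : X' ∈ s δ')
    (b : X.mid ⟶ X'.mid) (hb : X.i ≫ b = X'.i) :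
    ∃ c : C ⟶ C', pull E c δ' = δ ∧ X.p ≫ c = b ≫ X'.p := by
  have eX := h.R1 _ _ hX
  have eX' := h.R1 _ _ hX'
  obtain ⟨ρ, hl, hr⟩ : ∃ ρ : Ext E (C ⊞ C') A, pull E biprod.inl ρ = δ ∧
      pull E biprod.inr ρ = δ' :=
    ⟨pull E biprod.fst δ + pull E biprod.snd δ',
      by simp [← pull_comp, hE.pull_zero, pull_id], by simp [← pull_comp, hE.pull_zero, pull_id]⟩
  have hρ : push E X'.i ρ = 0 := by
    have e : ρ = pull E biprod.fst δ + pull E biprod.snd δ' := by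
      rw [← hl, ← hr, ← pull_comp, ← pull_comp, ← hE.pull_add, biprod.total, pull_id]
    rw [e, map_add, ← pull_push, ← pull_push, eX'.push_i, ← hb, push_comp, eX.push_i]
    simp
  obtain ⟨Y, hY⟩ := h.exists_mem ρ
  have eY := h.R1 _ _ hY
  obtain ⟨y, hy, hK⟩ := h.EA2 ρ biprod.inr X' (hr ▸ hX') Y hY
  rw [hρ] at hK
  have eK := h.R1 _ _ hK
  obtain ⟨(z : C ⟶ C' ⊞ Y.mid), hz⟩ := eK.pull_eq_zero_imp biprod.inl (map_zero _)
  obtain ⟨(r : C' ⊞ Y.mid ⟶ X'.mid), hr'⟩ := eK.push_eq_zero_imp (𝟙 _) (map_zero _)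
  change z ≫ biprod.desc biprod.inr Y.p = _ at hz
  change biprod.lift (-X'.p) y ≫ r = _ at hr'
  obtain ⟨x, hx⟩ := h.R0 δ ρ X hX Y hY (𝟙 A) biprod.inl
    (show push E (𝟙 A) δ = _ by rw [push_id, hl])
  have xi : X.i ≫ x = Y.i := by simpa using hx.comm_i
  have yi : X'.i ≫ y = Y.i := by simpa using hy.comm_i
  have cX : X.i ≫ X.p = 0 := eX.isComplex
  have cX' : X'.i ≫ X'.p = 0 := eX'.isComplex
  have hz' : z = biprod.lift (z ≫ biprod.fst) (z ≫ biprod.snd) := by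
    apply biprod.hom_ext <;> simp
  have hz₂ : (z ≫ biprod.fst) ≫ biprod.inr + (z ≫ biprod.snd) ≫ Y.p = biprod.inl := by
    rw [← hz]
    conv_rhs => rw [hz', biprod.lift_desc]
  -- The discrepancy between `x` and the splitting `z` of `biprod.inl` factors through the cone.
  obtain ⟨w, hw⟩ := eK.comp_p_eq_zero_imp
    (biprod.lift (-(X.p ≫ z ≫ biprod.fst)) (x - X.p ≫ z ≫ biprod.snd)) (by
      change _ ≫ biprod.desc biprod.inr Y.p = 0
      rw [biprod.lift_desc, Preadditive.sub_comp, ← hx.comm_p, ← hz₂]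
      simp)
  change w ≫ biprod.lift (-X'.p) y = _ at hw
  have hw₁ : w ≫ X'.p = X.p ≫ z ≫ biprod.fst := by simpa using hw =≫ biprod.fst
  have hw₂ : w ≫ y = x - X.p ≫ z ≫ biprod.snd := by simpa using hw =≫ biprod.snd
  have hwi : X.i ≫ w = X'.i := by
    have e : (X.i ≫ w) ≫ biprod.lift (-X'.p) y = X'.i ≫ biprod.lift (-X'.p) y := by
      apply biprod.hom_ext
      · simp [hw₁, reassoc_of% cX, cX']
      · simp [hw₂, reassoc_of% cX, xi, yi]
    simpa [hr'] using e =≫ r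
  obtain ⟨u, hu⟩ := eX.i_comp_eq_zero_imp (w - b) (by rw [Preadditive.comp_sub, hwi, hb, sub_self])
  refine ⟨z ≫ biprod.fst - u ≫ X'.p, ?_, ?_⟩
  · rw [hE.pull_sub, pull_comp _ X'.p, eX'.pull_p, map_zero, sub_zero, ← hl, ← hz₂, hE.pull_add,
      pull_comp _ Y.p, eY.pull_p, pull_comp _ biprod.inr, hr, map_zero, add_zero]
  · rw [Preadditive.comp_sub, reassoc_of% hu, Preadditive.sub_comp, hw₁, sub_sub_cancel]

/-- The case `c = 𝟙` of (ET3ᵒᵖ), dual to `exists_right`. -/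
theorem exists_left (hE : IsBiadditive E) (h : IsOneExangulated s) {δ : Ext E C A}
    {δ' : Ext E C A'} {X : Seq A C} (hX : X ∈ s δ) {X' : Seq A' C} (hX' : X' ∈ s δ')
    (b : X.mid ⟶ X'.mid) (hb : b ≫ X'.p = X.p) :
    ∃ a : A ⟶ A', push E a δ = δ' ∧ X.i ≫ b = a ≫ X'.i := by
  have eX := h.R1 _ _ hX
  have eX' := h.R1 _ _ hX'
  obtain ⟨ρ, hl, hr⟩ : ∃ ρ : Ext E C (A ⊞ A'), push E biprod.fst ρ = δ ∧
      push E biprod.snd ρ = δ' :=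
    ⟨push E biprod.inl δ + push E biprod.inr δ',
      by simp [← push_comp, hE.push_zero, push_id], by simp [← push_comp, hE.push_zero, push_id]⟩
  have hρ : pull E X.p ρ = 0 := by
    have e : ρ = push E biprod.inl δ + push E biprod.inr δ' := by
      rw [← hl, ← hr, ← push_comp, ← push_comp, ← hE.push_add, biprod.total, push_id]
    rw [e, map_add, pull_push, pull_push, eX.pull_p, ← hb, pull_comp, eX'.pull_p]
    simp
  obtain ⟨Y, hY⟩ := h.exists_mem ρ
  have eY := h.R1 _ _ hY
  obtain ⟨y, hy, hK⟩ := h.EA2_op ρ biprod.fst Y hY X (hl ▸ hX)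
  rw [hρ] at hK
  have eK := h.R1 _ _ hK
  obtain ⟨(z : A ⊞ Y.mid ⟶ A'), hz⟩ := eK.push_eq_zero_imp biprod.snd (map_zero _)
  obtain ⟨(r : X.mid ⟶ A ⊞ Y.mid), hr'⟩ := eK.pull_eq_zero_imp (𝟙 _) (map_zero _)
  change biprod.lift biprod.fst Y.i ≫ z = _ at hz
  change r ≫ biprod.desc (-X.i) y = _ at hr'
  obtain ⟨x, hx⟩ := h.R0 ρ δ' Y hY X' hX' biprod.snd (𝟙 C)
    (show _ = pull E (𝟙 C) δ' by rw [pull_id, hr])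
  have xp : x ≫ X'.p = Y.p := by simpa using hx.comm_p.symm
  have yp : y ≫ X.p = Y.p := by simpa using hy.comm_p.symm
  have cX : X.i ≫ X.p = 0 := eX.isComplex
  have cX' : X'.i ≫ X'.p = 0 := eX'.isComplex
  have hz' : z = biprod.desc (biprod.inl ≫ z) (biprod.inr ≫ z) := by
    apply biprod.hom_ext' <;> simp
  have hz₂ : biprod.fst ≫ biprod.inl ≫ z + Y.i ≫ biprod.inr ≫ z = biprod.snd := by
    rw [← hz]
    conv_rhs => rw [hz', biprod.lift_desc]
  obtain ⟨w, hw⟩ := eK.i_comp_eq_zero_imp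
    (biprod.desc (-(biprod.inl ≫ z ≫ X'.i)) (x - biprod.inr ≫ z ≫ X'.i)) (by
      change biprod.lift biprod.fst Y.i ≫ _ = 0
      rw [biprod.lift_desc, Preadditive.comp_sub, hx.comm_i, ← hz₂]
      simp)
  change biprod.desc (-X.i) y ≫ w = _ at hw
  have hw₁ : X.i ≫ w = biprod.inl ≫ z ≫ X'.i := by simpa using biprod.inl ≫= hw
  have hw₂ : y ≫ w = x - biprod.inr ≫ z ≫ X'.i := by simpa using biprod.inr ≫= hw
  have hwp : w ≫ X'.p = X.p := by
    have e : biprod.desc (-X.i) y ≫ w ≫ X'.p = biprod.desc (-X.i) y ≫ X.p := by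
      apply biprod.hom_ext'
      · simp [reassoc_of% hw₁, cX, cX']
      · simp [reassoc_of% hw₂, cX', xp, yp]
    simpa [reassoc_of% hr'] using r ≫= e
  obtain ⟨u, hu⟩ := eX'.comp_p_eq_zero_imp (w - b) (by
    rw [Preadditive.sub_comp, hwp, hb, sub_self])
  refine ⟨biprod.inl ≫ z - X.i ≫ u, ?_, ?_⟩
  · rw [hE.push_sub, push_comp _ X.i, eX.push_i, map_zero, sub_zero, ← hr, ← hz₂, hE.push_add,
      push_comp _ Y.i, eY.push_i, push_comp _ biprod.fst, hl, map_zero, add_zero]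
  · rw [Preadditive.sub_comp, Category.assoc, Category.assoc, hu, Preadditive.comp_sub, hw₁,
      sub_sub_cancel]

/-- (ET3). Since the cocone of (EA2ᵒᵖ) is a weak pushout, `b` factors through a realization of
`a_* δ`, which reduces the claim to `exists_right`. -/
theorem exists_right_of_square (hE : IsBiadditive E) (h : IsOneExangulated s) {δ : Ext E C A}
    {δ' : Ext E C' A'} {X : Seq A C} (hX : X ∈ s δ) {X' : Seq A' C'} (hX' : X' ∈ s δ')
    (a : A ⟶ A') (b : X.mid ⟶ X'.mid) (hb : X.i ≫ b = a ≫ X'.i) :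
    ∃ c : C ⟶ C', IsExtHom E δ δ' a c ∧ X.p ≫ c = b ≫ X'.p := by
  obtain ⟨Z, hZ⟩ := h.exists_mem (push E a δ)
  obtain ⟨b', hb', hK⟩ := h.EA2_op δ a X hX Z hZ
  obtain ⟨e, he⟩ := (h.R1 _ _ hK).i_comp_eq_zero_imp (biprod.desc (-X'.i) b) (by
    change biprod.lift a X.i ≫ _ = 0
    rw [biprod.lift_desc, hb]
    simp)
  change biprod.desc (-Z.i) b' ≫ e = _ at he
  have he₁ : Z.i ≫ e = X'.i := by simpa using biprod.inl ≫= he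
  have he₂ : b' ≫ e = b := by simpa using biprod.inr ≫= he
  obtain ⟨c, hc, hc'⟩ := h.exists_right hE hZ hX' e he₁
  refine ⟨c, hc.symm, ?_⟩
  have : X.p = b' ≫ Z.p := by simpa using hb'.comm_p
  rw [this, Category.assoc, hc', reassoc_of% he₂]

/-- (ET3ᵒᵖ), dual to `exists_right_of_square`. -/
theorem exists_left_of_square (hE : IsBiadditive E) (h : IsOneExangulated s) {δ : Ext E C A}
    {δ' : Ext E C' A'} {X : Seq A C} (hX : X ∈ s δ) {X' : Seq A' C'} (hX' : X' ∈ s δ')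
    (b : X.mid ⟶ X'.mid) (c : C ⟶ C') (hb : X.p ≫ c = b ≫ X'.p) :
    ∃ a : A ⟶ A', IsExtHom E δ δ' a c ∧ X.i ≫ b = a ≫ X'.i := by
  obtain ⟨Z, hZ⟩ := h.exists_mem (pull E c δ')
  obtain ⟨b', hb', hK⟩ := h.EA2 δ' c Z hZ X' hX'
  obtain ⟨e, he⟩ := (h.R1 _ _ hK).comp_p_eq_zero_imp (biprod.lift (-X.p) b) (by
    change _ ≫ biprod.desc c X'.p = 0
    rw [biprod.lift_desc, ← hb]
    simp)
  change e ≫ biprod.lift (-Z.p) b' = _ at he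
  have he₁ : e ≫ Z.p = X.p := by simpa using he =≫ biprod.fst
  have he₂ : e ≫ b' = b := by simpa using he =≫ biprod.snd
  obtain ⟨a, ha, ha'⟩ := h.exists_left hE hX hZ e he₁
  refine ⟨a, ha, ?_⟩
  have : Z.i ≫ b' = X'.i := by simpa using hb'.comm_i
  rw [← he₂, reassoc_of% ha', this]

/-- An inflation determines the last term and the extension up to isomorphism. -/
theorem exists_iso_right (hE : IsBiadditive E) (h : IsOneExangulated s) {δ : Ext E C A}
    {δ' : Ext E C' A} {X : Seq A C} (hX : X ∈ s δ) {X' : Seq A C'} (hX' : X' ∈ s δ')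
    (b : X.mid ≅ X'.mid) (hb : X.i ≫ b.hom = X'.i) :
    ∃ c : C ≅ C', pull E c.hom δ' = δ ∧ X.p ≫ c.hom = b.hom ≫ X'.p := by
  obtain ⟨c, hc, hp⟩ := h.exists_right hE hX hX' b.hom hb
  obtain ⟨c', hc', hp'⟩ := h.exists_right hE hX' hX b.inv (by rw [← hb]; simp)
  have := (h.R1 _ _ hX).isIso_of_p_comp hE (c ≫ c') (by rw [reassoc_of% hp, hp']; simp)
    (by rw [pull_comp, hc', hc])
  have := (h.R1 _ _ hX').isIso_of_p_comp hE (c' ≫ c) (by rw [reassoc_of% hp', hp]; simp)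
    (by rw [pull_comp, hc, hc'])
  have := isIso_of_isIso_comp c c'
  exact ⟨asIso c, hc, hp⟩

/-- A deflation determines the first term and the extension up to isomorphism. -/
theorem exists_iso_left (hE : IsBiadditive E) (h : IsOneExangulated s) {δ : Ext E C A}
    {δ' : Ext E C A'} {X : Seq A C} (hX : X ∈ s δ) {X' : Seq A' C} (hX' : X' ∈ s δ')
    (b : X.mid ≅ X'.mid) (hb : b.hom ≫ X'.p = X.p) :
    ∃ a : A ≅ A', push E a.hom δ = δ' ∧ X.i ≫ b.hom = a.hom ≫ X'.i := by
  obtain ⟨a, ha, hi⟩ := h.exists_left hE hX hX' b.hom hb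
  obtain ⟨a', ha', hi'⟩ := h.exists_left hE hX' hX b.inv (by rw [← hb]; simp)
  have := (h.R1 _ _ hX).isIso_of_comp_i hE (a ≫ a') (by
    rw [Category.assoc, ← hi', ← reassoc_of% hi]; simp) (by rw [push_comp, ha, ha'])
  have := (h.R1 _ _ hX').isIso_of_comp_i hE (a' ≫ a) (by
    rw [Category.assoc, ← hi, ← reassoc_of% hi']; simp) (by rw [push_comp, ha', ha])
  have := isIso_of_isIso_comp a a'
  exact ⟨asIso a, ha, hi⟩

/-- (ET4). The composite `f ≫ g` is an inflation, with last term `G₀` say. On the one hand,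
(EA2) for a morphism `D ⟶ G₀` yields a cone `B ⟶ D ⊞ C ⟶ G₀`; on the other hand, a realization
`D ⟶ G ⟶ F` of `f'_* δ'` is part of a cocone `B ⟶ D ⊞ C ⟶ G`. A shear of `D ⊞ C` identifies the two
inflations, and therefore `G₀` with `G`. -/
theorem octahedron (hE : IsBiadditive E) (h : IsOneExangulated s) (f : A ⟶ B) (f' : B ⟶ D)
    (g : B ⟶ C) (g' : C ⟶ F) (δ : Ext E D A) (δ' : Ext E F B)
    (hf : (⟨B, f, f'⟩ : Seq A D) ∈ s δ) (hg : (⟨C, g, g'⟩ : Seq B F) ∈ s δ') :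
    ∃ (G : 𝒞) (h' : C ⟶ G) (d : D ⟶ G) (e : G ⟶ F) (δ'' : Ext E G A),
      f' ≫ d = g ≫ h' ∧ h' ≫ e = g' ∧
      (⟨C, f ≫ g, h'⟩ : Seq A G) ∈ s δ'' ∧
      (⟨G, d, e⟩ : Seq D F) ∈ s (push E f' δ') ∧
      pull E d δ'' = δ ∧
      push E f δ'' = pull E e δ' := by
  obtain ⟨G₀, k, ε, hk⟩ := h.EA1 f g ⟨_, _, _, hf⟩ ⟨_, _, _, hg⟩
  obtain ⟨d₀, hd₀, hd₀'⟩ := h.exists_right_of_square hE hf hk (𝟙 A) g (by simp)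
  replace hd₀ : δ = pull E d₀ ε := by simpa [IsExtHom, push_id] using hd₀
  change f' ≫ d₀ = g ≫ k at hd₀'
  obtain ⟨(β : B ⟶ C), hβ, hK⟩ := h.EA2 ε d₀ ⟨B, f, f'⟩ (hd₀ ▸ hf) _ hk
  have hβ₁ : f ≫ β = f ≫ g := by simpa using hβ.comm_i
  have hβ₂ : f' ≫ d₀ = β ≫ k := hβ.comm_p
  obtain ⟨(t : D ⟶ C), ht⟩ := (h.R1 _ _ hf).i_comp_eq_zero_imp (g - β)
    (show f ≫ (g - β) = 0 by rw [Preadditive.comp_sub, hβ₁, sub_self])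
  change f' ≫ t = g - β at ht
  obtain ⟨⟨W, d, e⟩, hW⟩ := h.exists_mem (push E f' δ')
  obtain ⟨(m : C ⟶ W), hm, hK'⟩ := h.EA2_op δ' f' _ hg _ hW
  have hm₂ : m ≫ e = g' := by simpa using hm.comm_p.symm
  -- The cone starts with `(-f', β)` and the cocone with `(f', g)`; as `f' ≫ t = g - β`, the shear `b`
  -- takes the former to the latter.
  let b : D ⊞ C ≅ D ⊞ C :=
    { hom := biprod.desc (-biprod.inl - t ≫ biprod.inr) biprod.inr
      inv := biprod.desc (-biprod.inl - t ≫ biprod.inr) biprod.inr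
      hom_inv_id := by apply biprod.hom_ext' <;> simp
      inv_hom_id := by apply biprod.hom_ext' <;> simp }
  obtain ⟨c, hc, hc'⟩ := h.exists_iso_right hE hK hK' b (by
    change biprod.lift (-f') β ≫ b.hom = biprod.lift f' g
    apply biprod.hom_ext <;> simp [b, ht])
  change biprod.desc d₀ k ≫ c.hom = b.hom ≫ biprod.desc (-d) m at hc'
  have hc₁ : d₀ ≫ c.hom = d - t ≫ m := by simpa [b] using biprod.inl ≫= hc'
  have hc₂ : k ≫ c.hom = m := by simpa [b] using biprod.inr ≫= hc'
  change pull E c.hom (pull E e δ') = push E f ε at hc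
  -- The isomorphism `c` matches `d` with `d₀ + t ≫ k`, not with `d₀`.
  have hW' : (⟨G₀, d₀ + t ≫ k, c.hom ≫ e⟩ : Seq D F) ∈ s (push E f' δ') := by
    rw [h.eq_isoClass hW]
    refine ⟨c.symm, ?_, ?_⟩
    · have : d = (d₀ + t ≫ k) ≫ c.hom := by simp [hc₁, hc₂]
      simp [this]
    · simp
  refine ⟨G₀, k, d₀ + t ≫ k, c.hom ≫ e, ε, ?_, by rw [reassoc_of% hc₂, hm₂], hk, hW', ?_, ?_⟩
  · rw [Preadditive.comp_add, hβ₂, reassoc_of% ht, ← Preadditive.add_comp, add_sub_cancel]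
  · have : pull E k ε = 0 := (h.R1 _ _ hk).pull_p
    rw [hE.pull_add, pull_comp _ k, this, map_zero, add_zero, hd₀]
  · rw [pull_comp, hc]

/-- (ET4ᵒᵖ), dual to `octahedron`. -/
theorem octahedron_op (hE : IsBiadditive E) (h : IsOneExangulated s) (f' : D ⟶ A) (f : A ⟶ B)
    (g' : F ⟶ B) (g : B ⟶ C) (δ : Ext E B D) (δ' : Ext E C F)
    (hf : (⟨A, f', f⟩ : Seq D B) ∈ s δ) (hg : (⟨B, g', g⟩ : Seq F C) ∈ s δ') :
    ∃ (G : 𝒞) (h' : G ⟶ A) (d : D ⟶ G) (e : G ⟶ F) (δ'' : Ext E C G),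
      d ≫ h' = f' ∧ h' ≫ f = e ≫ g' ∧
      (⟨A, h', f ≫ g⟩ : Seq G C) ∈ s δ'' ∧
      (⟨G, d, e⟩ : Seq D F) ∈ s (pull E g' δ) ∧
      push E e δ'' = δ' ∧
      push E d δ = pull E g δ'' := by
  obtain ⟨G₀, k, ε, hk⟩ := h.EA1_op f g ⟨_, _, _, hf⟩ ⟨_, _, _, hg⟩
  obtain ⟨e₀, he₀, he₀'⟩ := h.exists_left_of_square hE hk hg f (𝟙 C) (by simp)
  replace he₀ : push E e₀ ε = δ' := by simpa [IsExtHom, pull_id] using he₀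
  change k ≫ f = e₀ ≫ g' at he₀'
  obtain ⟨(β : A ⟶ B), hβ, hK'⟩ := h.EA2_op ε e₀ _ hk ⟨B, g', g⟩ (he₀ ▸ hg)
  have hβ₁ : k ≫ β = e₀ ≫ g' := hβ.comm_i
  have hβ₂ : β ≫ g = f ≫ g := by simpa using hβ.comm_p.symm
  obtain ⟨(t : A ⟶ F), ht⟩ := (h.R1 _ _ hg).comp_p_eq_zero_imp (f - β)
    (show (f - β) ≫ g = 0 by rw [Preadditive.sub_comp, hβ₂, sub_self])
  change t ≫ g' = f - β at ht
  obtain ⟨⟨W, d, e⟩, hW⟩ := h.exists_mem (pull E g' δ)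
  obtain ⟨(m : W ⟶ A), hm, hK⟩ := h.EA2 δ g' _ hW _ hf
  have hm₁ : d ≫ m = f' := by simpa using hm.comm_i
  have hm₂ : e ≫ g' = m ≫ f := hm.comm_p
  let b : F ⊞ A ≅ F ⊞ A :=
    { hom := biprod.desc (-biprod.inl) (biprod.inr - t ≫ biprod.inl)
      inv := biprod.desc (-biprod.inl) (biprod.inr - t ≫ biprod.inl)
      hom_inv_id := by apply biprod.hom_ext' <;> simp
      inv_hom_id := by apply biprod.hom_ext' <;> simp }
  obtain ⟨a, ha, ha'⟩ := h.exists_iso_left hE hK hK' b (by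
    change b.hom ≫ biprod.desc (-g') β = biprod.desc g' f
    apply biprod.hom_ext' <;> simp [b, ht])
  change biprod.lift (-e) m ≫ b.hom = a.hom ≫ biprod.lift e₀ k at ha'
  have ha₁ : e - m ≫ t = a.hom ≫ e₀ := by
    simpa [b, sub_eq_add_neg] using ha' =≫ biprod.fst
  have ha₂ : m = a.hom ≫ k := by simpa [b] using ha' =≫ biprod.snd
  change push E a.hom (push E d δ) = pull E g ε at ha
  have hW' : (⟨G₀, d ≫ a.hom, e₀ + k ≫ t⟩ : Seq D F) ∈ s (pull E g' δ) := by
    rw [h.eq_isoClass hW]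
    refine ⟨a, ?_, ?_⟩
    · simp
    · simp [← ha₁, ← reassoc_of% ha₂]
  refine ⟨G₀, k, d ≫ a.hom, e₀ + k ≫ t, ε, by rw [Category.assoc, ← ha₂, hm₁], ?_, hk, hW', ?_, ?_⟩
  · rw [Preadditive.add_comp, Category.assoc, ht, Preadditive.comp_sub, hβ₁, he₀', add_sub_cancel]
  · have : push E k ε = 0 := (h.R1 _ _ hk).push_i
    rw [hE.push_add, push_comp _ k, this, map_zero, add_zero, he₀]
  · rw [push_comp, ha]

theorem isExtriangulated (hE : IsBiadditive E) (h : IsOneExangulated s) : IsExtriangulated s where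
  ET1 := hE
  ET2 := h.toIsExactRealization.isAdditiveRealization hE
  ET3 _ _ _ _ _ _ _ hX _ hX' a b hb := h.exists_right_of_square hE hX hX' a b hb
  ET3_op _ _ _ _ _ _ _ hX _ hX' b c hb := h.exists_left_of_square hE hX hX' b c hb
  ET4 _ _ _ _ _ := h.octahedron hE
  ET4_op _ _ _ _ _ := h.octahedron_op hE

end IsOneExangulated

end OneExangulated

/-! ### From extriangulated to `1`-exangulated -/

section Extriangulated

variable {𝒞 : Type u} [Category.{v} 𝒞] [Preadditive 𝒞] [HasBinaryBiproducts 𝒞]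
  {E : 𝒞ᵒᵖ ⥤ 𝒞 ⥤ AddCommGrpCat.{w}} {s : Correspondence E} {A B C D Z : 𝒞}

theorem isoEquiv_splitSeq_of_isZero_right (A : 𝒞) (hZ : IsZero Z) :
    IsoEquiv (splitSeq A Z) ⟨A, 𝟙 A, 0⟩ := by
  let b : A ⊞ Z ≅ A :=
    { hom := biprod.fst
      inv := biprod.inl
      hom_inv_id := by apply biprod.hom_ext' <;> simp [hZ.eq_of_src _ 0] }
  exact ⟨b, by simp [splitSeq, b], hZ.eq_of_tgt _ _⟩

theorem isoEquiv_splitSeq_of_isZero_left (C : 𝒞) (hZ : IsZero Z) :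
    IsoEquiv (splitSeq Z C) ⟨C, 0, 𝟙 C⟩ := by
  let b : Z ⊞ C ≅ C :=
    { hom := biprod.snd
      inv := biprod.inr
      hom_inv_id := by apply biprod.hom_ext' <;> simp [hZ.eq_of_src _ 0] }
  exact ⟨b, hZ.eq_of_src _ _, by simp [splitSeq, b]⟩

namespace IsExtriangulated

theorem id_zero_mem (h : IsExtriangulated s) (A : 𝒞) (hZ : IsZero Z) :
    (⟨A, 𝟙 A, 0⟩ : Seq A Z) ∈ s (0 : Ext E Z A) := by
  rw [h.ET2.split]
  exact isoEquiv_splitSeq_of_isZero_right A hZ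

theorem zero_id_mem (h : IsExtriangulated s) (C : 𝒞) (hZ : IsZero Z) :
    (⟨C, 0, 𝟙 C⟩ : Seq Z C) ∈ s (0 : Ext E C Z) := by
  rw [h.ET2.split]
  exact isoEquiv_splitSeq_of_isZero_left C hZ

theorem eq_isoClass (h : IsExtriangulated s) {δ : Ext E C A} {X : Seq A C} (hX : X ∈ s δ) :
    s δ = isoClass X := by
  obtain ⟨Y, e⟩ := h.ET2.class_eq δ
  rw [e]
  exact isoClass_eq_of_mem (e ▸ hX)

variable [HasZeroObject 𝒞]

open ZeroObject in
/-- Exactness of the sequences attached to a realization follows by applying (ET3) and (ET3ᵒᵖ) to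
the trivial sequences `Q ⟶ Q ⟶ 0` and `0 ⟶ Q ⟶ Q`. -/
theorem isExangle (h : IsExtriangulated s) {δ : Ext E C A} {X : Seq A C} (hX : X ∈ s δ) :
    IsExangle X δ := by
  have hZ : IsZero (0 : 𝒞) := isZero_zero 𝒞
  refine .of_lifts ?_ ?_ ?_ ?_ ?_ ?_ ?_
  · obtain ⟨c, -, hc⟩ := h.ET3 _ _ _ (h.id_zero_mem A hZ) X hX (𝟙 A) X.i (by simp)
    simpa [Seq.IsComplex] using hc.symm
  · obtain ⟨a, ha, -⟩ := h.ET3_op _ _ _ (h.zero_id_mem X.mid hZ) X hX (𝟙 _) X.p (by simp)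
    simpa [IsExtHom] using ha.symm
  · obtain ⟨c, hc, -⟩ := h.ET3 _ _ X hX _ (h.id_zero_mem X.mid hZ) X.i (𝟙 _) (by simp)
    simpa [IsExtHom] using hc
  · intro Q f hf
    obtain ⟨a, -, ha⟩ := h.ET3_op _ _ _ (h.id_zero_mem Q hZ) X hX f 0 (by simp [hf])
    exact ⟨a, by simpa using ha.symm⟩
  · intro Q f hf
    obtain ⟨b, hb⟩ := h.ET2.lifts _ _ _ (h.zero_id_mem Q hZ) X hX 0 f (by simp [IsExtHom, hf])
    exact ⟨b, by simpa using hb.comm_p.symm⟩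
  · intro Q f hf
    obtain ⟨c, -, hc⟩ := h.ET3 _ _ X hX _ (h.zero_id_mem Q hZ) 0 f (by simp [hf])
    exact ⟨c, by simpa using hc⟩
  · intro Q f hf
    obtain ⟨b, hb⟩ := h.ET2.lifts _ _ X hX _ (h.id_zero_mem Q hZ) f 0 (by simp [IsExtHom, hf])
    exact ⟨b, by simpa using hb.comm_i⟩

theorem isExactRealization (h : IsExtriangulated s) : IsExactRealization s where
  class_eq C A δ := by
    obtain ⟨X, e⟩ := h.ET2.class_eq δ
    have hX := h.isExangle (e ▸ self_mem_isoClass X : X ∈ s δ)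
    exact ⟨X, hX.isComplex, by rw [e, hX.htpyClass_eq_isoClass]⟩
  R0 := h.ET2.lifts
  R1 _ _ _ _ hX := h.isExangle hX
  R2 A Z hZ := by
    have hX := h.id_zero_mem A hZ
    rw [h.eq_isoClass hX, (h.isExangle hX).htpyClass_eq_isoClass]
  R2_op A Z hZ := by
    have hX := h.zero_id_mem A hZ
    rw [h.eq_isoClass hX, (h.isExangle hX).htpyClass_eq_isoClass]

open ZeroObject in
/-- Adding a trivial sequence `0 ⟶ C ⟶ C` to a realization. -/
theorem id_map_mem (h : IsExtriangulated s) (C : 𝒞) {ρ : Ext E D A} {Y : Seq A D}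
    (hY : Y ∈ s ρ) :
    (⟨C ⊞ Y.mid, Y.i ≫ biprod.inr, biprod.map (𝟙 C) Y.p⟩ : Seq A (C ⊞ D)) ∈
      s (pull E biprod.snd ρ) := by
  have hsum : sumSeq ⟨C, 0, 𝟙 C⟩ Y ∈ s (sumExt E (0 : Ext E C (0 : 𝒞)) ρ) := by
    rw [h.ET2.sum _ _ _ (h.zero_id_mem C (isZero_zero 𝒞)) _ hY]
    exact self_mem_isoClass _
  let a : (0 : 𝒞) ⊞ A ≅ A := ⟨biprod.snd, biprod.inr, by ext; simp, by simp⟩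
  refine h.isExactRealization.mem_of_iso hsum a (Iso.refl _) (Iso.refl _) ?_ ?_ ?_
  · change push E biprod.snd (sumExt E 0 ρ) = pull E (𝟙 _) _
    rw [push_snd_sumExt h.ET1, pull_id]
  · apply biprod.hom_ext' <;> simp [sumSeq, a]
  · simp [sumSeq]

open ZeroObject in
/-- Adding a trivial sequence `B ⟶ B ⟶ 0` to a realization. -/
theorem map_id_mem (h : IsExtriangulated s) (B : 𝒞) {δ : Ext E C A} {X : Seq A C}
    (hX : X ∈ s δ) :
    (⟨B ⊞ X.mid, biprod.map (𝟙 B) X.i, biprod.snd ≫ X.p⟩ : Seq (B ⊞ A) C) ∈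
      s (push E biprod.inr δ) := by
  have hsum : sumSeq ⟨B, 𝟙 B, 0⟩ X ∈ s (sumExt E (0 : Ext E (0 : 𝒞) B) δ) := by
    rw [h.ET2.sum _ _ _ (h.id_zero_mem B (isZero_zero 𝒞)) _ hX]
    exact self_mem_isoClass _
  let c : (0 : 𝒞) ⊞ C ≅ C := ⟨biprod.snd, biprod.inr, by ext; simp, by simp⟩
  refine h.isExactRealization.mem_of_iso hsum (Iso.refl _) (Iso.refl _) c ?_ ?_ ?_
  · change push E (𝟙 _) (sumExt E 0 δ) = pull E biprod.snd (push E biprod.inr δ)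
    rw [push_id, sumExt]
    simp [pull_push]
  · simp [sumSeq]
  · apply biprod.hom_ext' <;> simp [sumSeq, c]

/-- (EA2). The morphism `biprod.desc c Y.p` is the composite of the deflations
`biprod.map (𝟙 C) Y.p` and `biprod.desc c (𝟙 D)`, the second of which splits. Applying (ET4ᵒᵖ) to
this composite yields both the lift and its cone. -/
theorem exists_cone_mem (h : IsExtriangulated s) (ρ : Ext E D A) (c : C ⟶ D) {X : Seq A C}
    (hX : X ∈ s (pull E c ρ)) {Y : Seq A D} (hY : Y ∈ s ρ) :
    ∃ b : X.mid ⟶ Y.mid, IsSeqHom X Y (𝟙 A) b c ∧ cone X Y b c ∈ s (push E X.i ρ) := by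
  have hsplit : (⟨C ⊞ D, biprod.lift (-𝟙 C) c, biprod.desc c (𝟙 D)⟩ : Seq C D) ∈
      s (0 : Ext E D C) := by
    rw [h.ET2.split]
    let b : C ⊞ D ≅ C ⊞ D :=
      { hom := biprod.desc (biprod.lift (-𝟙 C) c) biprod.inr
        inv := biprod.desc (biprod.lift (-𝟙 C) c) biprod.inr
        hom_inv_id := by ext <;> simp
        inv_hom_id := by ext <;> simp }
    refine ⟨b, ?_, ?_⟩
    · simp [splitSeq, b]
    · change biprod.snd ≫ 𝟙 D = b.hom ≫ biprod.desc c (𝟙 D)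
      apply biprod.hom_ext' <;> simp [b]
  obtain ⟨G, k, d, e, δ'', hd, hk, hG, hde, -, hδ⟩ :=
    h.ET4_op _ _ _ _ _ _ (h.id_map_mem C hY) hsplit
  rw [← pull_comp, biprod.lift_snd] at hde
  -- The first component of `k` is `-e`, and the second one is the lift of `c`.
  have hk₁ : k ≫ biprod.fst = -e := by simpa using hk =≫ biprod.fst
  have hk₂ : (k ≫ biprod.snd) ≫ Y.p = e ≫ c := by simpa using hk =≫ biprod.snd
  have hd₂ : d ≫ k ≫ biprod.snd = Y.i := by simpa using hd =≫ biprod.snd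
  have hδ' : push E d ρ = δ'' := by
    have := congrArg (pull E biprod.inr) hδ
    rwa [pull_push, ← pull_comp, ← pull_comp, biprod.inr_snd, biprod.inr_desc, pull_id,
      pull_id] at this
  obtain ⟨φ, hφ⟩ : IsoEquiv X ⟨G, d, e⟩ := by
    rw [h.eq_isoClass hX] at hde
    exact hde
  have φi : X.i ≫ φ.hom = d := by simpa using hφ.comm_i
  have φp : φ.hom ≫ e = X.p := by simpa using hφ.comm_p.symm
  refine ⟨φ.hom ≫ k ≫ biprod.snd, ⟨?_, ?_⟩, ?_⟩
  · rw [reassoc_of% φi, hd₂, Category.id_comp]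
  · rw [← φp, Category.assoc, Category.assoc, hk₂]
  · refine h.isExactRealization.mem_of_iso hG φ.symm (Iso.refl _) (Iso.refl _) ?_ ?_ ?_
    · change push E φ.inv δ'' = pull E (𝟙 _) _
      rw [pull_id, ← hδ', ← φi, push_comp, ← push_comp _ φ.hom, φ.hom_inv_id, push_id]
    · change k ≫ 𝟙 _ = φ.inv ≫ biprod.lift (-X.p) (φ.hom ≫ k ≫ biprod.snd)
      apply biprod.hom_ext <;> simp [hk₁, ← φp]
    · change (biprod.map (𝟙 C) Y.p ≫ biprod.desc c (𝟙 D)) ≫ 𝟙 _ = 𝟙 _ ≫ biprod.desc c Y.p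
      ext <;> simp

/-- (EA2ᵒᵖ), dual to `exists_cone_mem`. -/
theorem exists_cocone_mem (h : IsExtriangulated s) (δ : Ext E C A) (a : A ⟶ B) {X : Seq A C}
    (hX : X ∈ s δ) {Y : Seq B C} (hY : Y ∈ s (push E a δ)) :
    ∃ b : X.mid ⟶ Y.mid, IsSeqHom X Y a b (𝟙 C) ∧ cocone X Y a b ∈ s (pull E Y.p δ) := by
  have hsplit : (⟨B ⊞ A, biprod.lift a (𝟙 A), biprod.desc (-𝟙 B) a⟩ : Seq A B) ∈
      s (0 : Ext E B A) := by
    rw [h.ET2.split]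
    let b : A ⊞ B ≅ B ⊞ A :=
      { hom := biprod.desc (biprod.lift a (𝟙 A)) (-biprod.inl)
        inv := biprod.lift biprod.snd (biprod.desc (-𝟙 B) a)
        hom_inv_id := by ext <;> simp
        inv_hom_id := by ext <;> simp }
    refine ⟨b, ?_, ?_⟩
    · simp [splitSeq, b]
    · change biprod.snd ≫ 𝟙 B = b.hom ≫ biprod.desc (-𝟙 B) a
      apply biprod.hom_ext' <;> simp [b]
  obtain ⟨G, k, d, e, δ'', hd, hk, hG, hde, -, hδ⟩ :=
    h.ET4 _ _ _ _ _ _ hsplit (h.map_id_mem B hX)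
  rw [← push_comp, biprod.inr_desc] at hde
  -- The first component of `k` is `-d`, and the second one is the lift of `a`.
  have hk₁ : biprod.inl ≫ k = -d := by simpa using (biprod.inl ≫= hd).symm
  have hk₂ : X.i ≫ biprod.inr ≫ k = a ≫ d := by simpa using (biprod.inr ≫= hd).symm
  have he₂ : biprod.inr ≫ k ≫ e = X.p := by simpa using biprod.inr ≫= hk
  have hδ' : δ'' = pull E e δ := by
    have := congrArg (push E biprod.snd) hδ
    rwa [← pull_push, ← push_comp, ← push_comp, biprod.inr_snd, biprod.lift_snd, push_id,
      push_id] at this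
  obtain ⟨φ, hφ⟩ : IsoEquiv ⟨G, d, e⟩ Y := by
    rw [h.eq_isoClass hY] at hde
    exact IsoEquiv.symm hde
  have φi : d ≫ φ.hom = Y.i := by simpa using hφ.comm_i
  have φp : φ.hom ≫ Y.p = e := by simpa using hφ.comm_p.symm
  refine ⟨biprod.inr ≫ k ≫ φ.hom, ⟨?_, ?_⟩, ?_⟩
  · rw [reassoc_of% hk₂, φi]
  · rw [Category.assoc, Category.assoc, φp, he₂, Category.comp_id]
  · refine h.isExactRealization.mem_of_iso hG (Iso.refl _) (Iso.refl _) φ ?_ ?_ ?_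
    · change push E (𝟙 _) δ'' = pull E φ.hom _
      rw [push_id, hδ', ← pull_comp, φp]
    · change (biprod.lift a (𝟙 A) ≫ biprod.map (𝟙 B) X.i) ≫ 𝟙 _ = 𝟙 _ ≫ biprod.lift a X.i
      ext <;> simp
    · change k ≫ φ.hom = 𝟙 _ ≫ biprod.desc (-Y.i) (biprod.inr ≫ k ≫ φ.hom)
      ext <;> simp [reassoc_of% hk₁, φi]

theorem isOneExangulated (h : IsExtriangulated s) : IsOneExangulated s where
  toIsExactRealization := h.isExactRealization
  EA1 := by
    rintro A B C f g ⟨D, f', δ, hf⟩ ⟨F, g', δ', hg⟩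
    obtain ⟨G, k, -, -, δ'', -, -, hk, -⟩ := h.ET4 f f' g g' δ δ' hf hg
    exact ⟨G, k, δ'', hk⟩
  EA1_op := by
    rintro A B C f g ⟨D, f', δ, hf⟩ ⟨F, g', δ', hg⟩
    obtain ⟨G, k, -, -, δ'', -, -, hk, -⟩ := h.ET4_op f' f g' g δ δ' hf hg
    exact ⟨G, k, δ'', hk⟩
  EA2 _ _ _ ρ c _ hX _ hY := h.exists_cone_mem ρ c hX hY
  EA2_op _ _ _ δ a _ hX _ hY := h.exists_cocone_mem δ a hX hY

end IsExtriangulated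

end Extriangulated

end Exangulated

theorem mainTheorem2 {𝒞 : Type u} [Category.{v} 𝒞] [Preadditive 𝒞] [HasZeroObject 𝒞]
    [HasBinaryBiproducts 𝒞]
    (E : 𝒞ᵒᵖ ⥤ 𝒞 ⥤ AddCommGrpCat.{w}) (hE : Exangulated.IsBiadditive E)
    (s : Exangulated.Correspondence E) :
    Exangulated.IsOneExangulated s ↔ Exangulated.IsExtriangulated s :=
  ⟨fun h => h.isExtriangulated hE, fun h => h.isOneExangulated⟩
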